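/- Let null infinity be $\mathscr I\cong\mathbb R\times\mathbb S^2$, with null coordinate $\xi^1=u\in\mathbb R$, null normal $n=\partial_u$, and spatial coordinates $\xi^M$ on $\mathbb S^2$. Let $q_{MN}$ be a smooth Riemannian metric on $\mathbb S^2$ (independent of $u$) of constant scalar curvature $\mathcal R>0$, with Levi-Civita connection $D_M$. Let $J\subseteq\mathbb R$ be open ($J=\mathbb R$ gives all of $\mathscr I$). For every tensor field $S_{MN}(u,\cdot)$ of covariant 2-tensors on $\mathbb S^2$ depending on $u$, the following are equivalent: (a) on $J\times\mathbb S^2$, $S_{MN}$ is smooth and symmetric, satisfies the no-outgoing-radiation constraints $$D_M S_{NP}-D_N S_{MP}=0,\qquad \partial_n S_{MN}=0,$$ and has trace $S^M{}_M=q^{MN}S_{MN}=\mathcal R$; (b) $S_{MN}=\tfrac12\,\mathcal R\,q_{MN}$ on $J\times\mathbb S^2$. That is, $S_{MN}=\frac12\mathcal R\,q_{MN}$ is the unique smooth symmetric solution of the constraints whose trace is $\mathcal R$. -/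

import Mathlib

open scoped Manifold ContDiff

noncomputable section

namespace NullInfinity

/-- The coordinate space of the spatial coordinates. -/
abbrev E2 : Type := EuclideanSpace ℝ (Fin 2)

instance finrankFact : Fact (Module.finrank ℝ (EuclideanSpace ℝ (Fin 3)) = 2 + 1) :=
  ⟨finrank_euclideanSpace_fin⟩

/-- The two-sphere, with Mathlib's smooth structure. Null infinity is `ℝ × Sph`; the first factor
carries the null coordinate, along the null normal `n`. -/
abbrev Sph : Type := Metric.sphere (0 : EuclideanSpace ℝ (Fin 3)) 1

/-- A bilinear form on each tangent space of the sphere: a field of covariant 2-tensors. -/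
abbrev Tensor2 : Type :=
  ∀ x : Sph, TangentSpace (𝓡 2) x →L[ℝ] TangentSpace (𝓡 2) x →L[ℝ] ℝ

/-- Smooth Riemannian metrics on the sphere. -/
abbrev Metric2 : Type :=
  Bundle.ContMDiffRiemannianMetric (𝓡 2) ∞ E2 (fun x : Sph => TangentSpace (𝓡 2) x)

/-- The smooth local coordinate systems of the sphere. -/
abbrev IsChart (e : OpenPartialHomeomorph Sph E2) : Prop :=
  e ∈ IsManifold.maximalAtlas (𝓡 2) ∞ Sph

/-- The coordinate vector field `∂_M` of the chart `e`, at the point with coordinates `y`. -/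
def coordVec (e : OpenPartialHomeomorph Sph E2) (y : E2) (M : Fin 2) :
    TangentSpace (𝓡 2) (e.symm y) :=
  mfderiv (𝓡 2) (𝓡 2) e.symm y (EuclideanSpace.single M (1 : ℝ) : E2)

/-- The matrix of components `T_MN = T(∂_M, ∂_N)` in the chart `e`, as a function of the
coordinates (meaningful on `e.target`). -/
def comp (T : Tensor2) (e : OpenPartialHomeomorph Sph E2) (y : E2) :
    Matrix (Fin 2) (Fin 2) ℝ :=
  Matrix.of fun M N => T (e.symm y) (coordVec e y M) (coordVec e y N)

/-- The partial derivative `∂_M f`. -/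
def pd (M : Fin 2) (f : E2 → ℝ) (y : E2) : ℝ :=
  fderiv ℝ f y (EuclideanSpace.single M (1 : ℝ))

/-- The Christoffel symbol
`Γ^P_MN = ½ g^{PL} (∂_M g_LN + ∂_N g_LM - ∂_L g_MN)`. -/
def christoffel (g : E2 → Matrix (Fin 2) (Fin 2) ℝ) (P M N : Fin 2) (y : E2) : ℝ :=
  (1 / 2) * ∑ L, (g y)⁻¹ P L *
    (pd M (fun z => g z L N) y + pd N (fun z => g z L M) y - pd L (fun z => g z M N) y)

/-- The Levi-Civita covariant derivative
`D_M T_NP = ∂_M T_NP - Γ^L_MN T_LP - Γ^L_MP T_NL`. -/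
def covDeriv (g T : E2 → Matrix (Fin 2) (Fin 2) ℝ) (M N P : Fin 2) (y : E2) : ℝ :=
  pd M (fun z => T z N P) y - ∑ L, christoffel g L M N y * T y L P
    - ∑ L, christoffel g L M P y * T y N L

/-- The Riemann tensor
`R^P_LMN = ∂_M Γ^P_NL - ∂_N Γ^P_ML + Γ^P_MA Γ^A_NL - Γ^P_NA Γ^A_ML`,
so that `D_M D_N V^P - D_N D_M V^P = R^P_LMN V^L`. -/
def riemann (g : E2 → Matrix (Fin 2) (Fin 2) ℝ) (P L M N : Fin 2) (y : E2) : ℝ :=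
  pd M (christoffel g P N L) y - pd N (christoffel g P M L) y
    + ∑ A, (christoffel g P M A y * christoffel g A N L y
      - christoffel g P N A y * christoffel g A M L y)

/-- The Ricci tensor `R_LN = R^M_LMN`. -/
def ricci (g : E2 → Matrix (Fin 2) (Fin 2) ℝ) (L N : Fin 2) (y : E2) : ℝ :=
  ∑ M, riemann g M L M N y

/-- The scalar curvature `g^{LN} R_LN` (equal to `2 / r ^ 2` for a round sphere of radius `r`). -/
def scalarCurv (g : E2 → Matrix (Fin 2) (Fin 2) ℝ) (y : E2) : ℝ :=
  ∑ L, ∑ N, (g y)⁻¹ L N * ricci g L N y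

/-- The metric `q` has constant scalar curvature `R`. -/
def HasScalarCurvature (q : Metric2) (R : ℝ) : Prop :=
  ∀ e, IsChart e → ∀ y ∈ e.target, scalarCurv (comp q.inner e) y = R

/-- The spatial tensor field `S_MN` depending on the null coordinate is smooth on the part of null
infinity where the null coordinate lies in `J`. -/
def SmoothOn (J : Set ℝ) (S : ℝ → Tensor2) : Prop :=
  ∀ e, IsChart e → ∀ M N : Fin 2,
    ContDiffOn ℝ ∞ (fun p : ℝ × E2 => comp (S p.1) e p.2 M N) (J ×ˢ e.target)

/-- `S_MN = S_NM`. -/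
def SymmOn (J : Set ℝ) (S : ℝ → Tensor2) : Prop :=
  ∀ u ∈ J, ∀ (x : Sph) (v w : TangentSpace (𝓡 2) x), S u x v w = S u x w v

/-- `S^M_M = q^{MN} S_MN = R`. -/
def TraceOn (q : Metric2) (R : ℝ) (J : Set ℝ) (S : ℝ → Tensor2) : Prop :=
  ∀ u ∈ J, ∀ e, IsChart e → ∀ y ∈ e.target,
    ∑ M, ∑ N, (comp q.inner e y)⁻¹ M N * comp (S u) e y M N = R

/-- `D_[M S_N]P = D_M S_NP - D_N S_MP = 0`, with `D` the Levi-Civita connection of `q`. -/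
def CodazziOn (q : Metric2) (J : Set ℝ) (S : ℝ → Tensor2) : Prop :=
  ∀ u ∈ J, ∀ e, IsChart e → ∀ y ∈ e.target, ∀ M N P : Fin 2,
    covDeriv (comp q.inner e) (comp (S u) e) M N P y
      - covDeriv (comp q.inner e) (comp (S u) e) N M P y = 0

/-- `∂ₙ S_MN = 0`: the derivative of the components along the null coordinate vanishes. -/
def StationaryOn (J : Set ℝ) (S : ℝ → Tensor2) : Prop :=
  ∀ u ∈ J, ∀ e, IsChart e → ∀ y ∈ e.target, ∀ M N : Fin 2,
    deriv (fun s => comp (S s) e y M N) u = 0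

end NullInfinity

end

/-! The metric is parallel and has trace 2, so `T = S - (R/2) q` is, at each fixed `u`, a symmetric
trace-free Codazzi tensor on the sphere. The claim becomes that such a tensor vanishes when the
curvature is positive. This is a Bochner argument, run with a maximum principle instead of an
integration.

Let `f = -det T / det q`, which is `|T|²/2` for trace-free `T`; it is independent of the chart and
continuous, so it attains a maximum on the compact sphere. Suppose the maximum is positive. The
Codazzi equation and the trace condition make `DT` totally symmetric and trace-free, leaving two
free components, and `df = 0` is a nondegenerate linear system for them, so `DT = 0` at that point
(`covDeriv_eq_zero_of_critical`). The Codazzi equation, the Ricci identity and the form of the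
Riemann tensor in dimension two then give `ΔT = R T`, hence `Δf = 2 R f > 0` there, contradicting
maximality (`det_nonneg_of_isLocalMax`). So `f ≤ 0` everywhere, which forces `T = 0`
(`eq_zero_of_trace_det`). The converse is metric compatibility, `Dq = 0`. -/

noncomputable section

namespace NullInfinity

/-! ### Partial derivatives -/

section PartialDerivatives

variable {f h : E2 → ℝ} {y : E2}

theorem pd_add (M : Fin 2) (hf : DifferentiableAt ℝ f y) (hh : DifferentiableAt ℝ h y) :
    pd M (fun z => f z + h z) y = pd M f y + pd M h y := by
  simp [pd, fderiv_fun_add hf hh]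

theorem pd_sub (M : Fin 2) (hf : DifferentiableAt ℝ f y) (hh : DifferentiableAt ℝ h y) :
    pd M (fun z => f z - h z) y = pd M f y - pd M h y := by
  simp [pd, fderiv_fun_sub hf hh]

theorem pd_mul (M : Fin 2) (hf : DifferentiableAt ℝ f y) (hh : DifferentiableAt ℝ h y) :
    pd M (fun z => f z * h z) y = pd M f y * h y + f y * pd M h y := by
  simp [pd, fderiv_fun_mul hf hh]; ring

theorem pd_const_mul (M : Fin 2) (c : ℝ) (hf : DifferentiableAt ℝ f y) :
    pd M (fun z => c * f z) y = c * pd M f y := by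
  simp [pd, fderiv_const_mul hf]

theorem pd_congr (M : Fin 2) (hfh : f =ᶠ[nhds y] h) : pd M f y = pd M h y := by
  simp [pd, hfh.fderiv_eq]

theorem pd_const (M : Fin 2) (c : ℝ) : pd M (fun _ => c) y = 0 := by
  simp [pd]

theorem ContDiffAt.pd (M : Fin 2) (hf : ContDiffAt ℝ ∞ f y) : ContDiffAt ℝ ∞ (pd M f) y :=
  (hf.fderiv_right (m := ∞) (by simp)).clm_apply contDiffAt_const

theorem _root_.ContDiffAt.diffAt (hf : ContDiffAt ℝ ∞ f y) : DifferentiableAt ℝ f y :=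
  hf.differentiableAt (by simp)

theorem pd_pd_eq_fderiv (M N : Fin 2) (hf : ContDiffAt ℝ ∞ f y) :
    pd M (pd N f) y = fderiv ℝ (fderiv ℝ f) y (EuclideanSpace.single M (1 : ℝ))
      (EuclideanSpace.single N (1 : ℝ)) := by
  have h1 : DifferentiableAt ℝ (fderiv ℝ f) y :=
    (hf.fderiv_right (m := ∞) (by simp)).differentiableAt (by simp)
  have h2 := (h1.hasFDerivAt.clm_apply
    (hasFDerivAt_const (EuclideanSpace.single N (1 : ℝ) : E2) y)).fderiv
  have h3 : pd N f = fun z => fderiv ℝ f z (EuclideanSpace.single N (1 : ℝ)) := rfl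
  rw [pd, h3, h2]
  simp

theorem pd_comm (M N : Fin 2) (hf : ContDiffAt ℝ ∞ f y) : pd M (pd N f) y = pd N (pd M f) y := by
  rw [pd_pd_eq_fderiv M N hf, pd_pd_eq_fderiv N M hf]
  exact (hf.isSymmSndFDerivAt (by simpa using WithTop.coe_le_coe.2 (le_top : (2 : ℕ∞) ≤ ⊤))) _ _

/-- At a local maximum the partial derivatives vanish. -/
theorem pd_eq_zero_of_isLocalMax (hm : IsLocalMax f y) (M : Fin 2) : pd M f y = 0 := by
  simp [pd, hm.fderiv_eq_zero]

/-- Were the second derivative positive, the point would also be a local minimum. Then `φ` would be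
locally constant, with zero second derivative. -/
theorem deriv_deriv_nonpos_of_isLocalMax {φ : ℝ → ℝ} {t : ℝ} (hm : IsLocalMax φ t)
    (hc : ContinuousAt φ t) : deriv (deriv φ) t ≤ 0 := by
  by_contra! hpos
  have hmin := isLocalMin_of_deriv_deriv_pos hpos hm.deriv_eq_zero hc
  have hconst : φ =ᶠ[nhds t] fun _ => φ t := by
    filter_upwards [hm, hmin] with s h1 h2 using le_antisymm h1 h2
  have h0 : deriv (deriv φ) t = deriv (deriv fun _ => φ t) t := hconst.deriv.deriv_eq
  simp at h0
  linarith

theorem fderiv_fderiv_nonpos_of_isLocalMax (hf : ContDiffAt ℝ ∞ f y) (hm : IsLocalMax f y)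
    (v : E2) : fderiv ℝ (fderiv ℝ f) y v v ≤ 0 := by
  have hline : Continuous fun t : ℝ => y + t • v := by fun_prop
  have hline' : ∀ t : ℝ, HasDerivAt (fun t : ℝ => y + t • v) v t := fun t => by
    simpa using ((hasDerivAt_id t).smul_const v).const_add y
  have h0 : y + (0 : ℝ) • v = y := by simp
  have ht : Filter.Tendsto (fun t : ℝ => y + t • v) (nhds 0) (nhds y) := by
    simpa using hline.tendsto 0
  have hmax : IsLocalMax (fun t : ℝ => f (y + t • v)) 0 := by
    have := ht.eventually hm
    simpa [IsLocalMax, IsMaxFilter] using this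
  have hd : deriv (fun t : ℝ => f (y + t • v)) =ᶠ[nhds 0] fun t => fderiv ℝ f (y + t • v) v := by
    have hev : ∀ᶠ z in nhds y, DifferentiableAt ℝ f z :=
      ((hf.of_le (m := 1) (by simp)).eventually (by simp)).mono
        fun z hz => hz.differentiableAt (by simp)
    filter_upwards [ht.eventually hev] with t hdt
    exact (hdt.hasFDerivAt.comp_hasDerivAt t (hline' t)).deriv
  have h1 : DifferentiableAt ℝ (fderiv ℝ f) (y + (0 : ℝ) • v) := by
    rw [h0]; exact (hf.fderiv_right (m := ∞) (by simp)).differentiableAt (by simp)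
  have h2 : HasDerivAt (fun t : ℝ => fderiv ℝ f (y + t • v))
      (fderiv ℝ (fderiv ℝ f) (y + (0 : ℝ) • v) v) 0 :=
    h1.hasFDerivAt.comp_hasDerivAt (0 : ℝ) (hline' 0)
  have h3 := (h2.clm_apply (hasDerivAt_const (0 : ℝ) v)).deriv
  rw [h0, map_zero, add_zero] at h3
  have hcont : ContinuousAt (fun t : ℝ => f (y + t • v)) 0 :=
    ContinuousAt.comp (f := fun t : ℝ => y + t • v) (g := f)
      (by rw [h0]; exact hf.continuousAt) hline.continuousAt
  have key := deriv_deriv_nonpos_of_isLocalMax hmax hcont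
  rwa [hd.deriv_eq, h3] at key

/-- At a local maximum the Hessian is negative semidefinite. -/
theorem hessian_nonpos_of_isLocalMax (hf : ContDiffAt ℝ ∞ f y) (hm : IsLocalMax f y) (a b : ℝ) :
    a ^ 2 * pd 0 (pd 0 f) y + 2 * a * b * pd 0 (pd 1 f) y + b ^ 2 * pd 1 (pd 1 f) y ≤ 0 := by
  have key := fderiv_fderiv_nonpos_of_isLocalMax hf hm
    (a • EuclideanSpace.single 0 (1 : ℝ) + b • EuclideanSpace.single 1 (1 : ℝ))
  have hc := pd_comm 0 1 hf
  rw [pd_pd_eq_fderiv 0 1 hf, pd_pd_eq_fderiv 1 0 hf] at hc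
  rw [pd_pd_eq_fderiv 0 0 hf, pd_pd_eq_fderiv 0 1 hf, pd_pd_eq_fderiv 1 1 hf]
  simp only [map_add, map_smul, add_apply, smul_apply, smul_eq_mul] at key
  rw [← hc] at key
  linarith

end PartialDerivatives

/-! ### Metrics in a coordinate domain -/

/-- The components `g` form a smooth positive definite symmetric matrix on the open set `U`. -/
structure IsMetricOn (g : E2 → Matrix (Fin 2) (Fin 2) ℝ) (U : Set E2) : Prop where
  isOpen : IsOpen U
  smooth : ∀ y ∈ U, ∀ i j, ContDiffAt ℝ ∞ (fun z => g z i j) y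
  symm : ∀ y i j, g y i j = g y j i
  pos : ∀ y ∈ U, 0 < g y 0 0
  det_pos : ∀ y ∈ U, 0 < g y 0 0 * g y 1 1 - g y 0 1 ^ 2

namespace IsMetricOn

variable {g T : E2 → Matrix (Fin 2) (Fin 2) ℝ} {U : Set E2} (hg : IsMetricOn g U)
include hg

/-- Adjugate over determinant. No positivity is needed: where the determinant vanishes, both sides
are zero by convention. -/
theorem inv_apply {y : E2} : (g y)⁻¹ =
    !![g y 1 1 / (g y 0 0 * g y 1 1 - g y 0 1 ^ 2), - g y 0 1 / (g y 0 0 * g y 1 1 - g y 0 1 ^ 2);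
      - g y 0 1 / (g y 0 0 * g y 1 1 - g y 0 1 ^ 2), g y 0 0 / (g y 0 0 * g y 1 1 - g y 0 1 ^ 2)]
    := by
  have h10 := hg.symm y 1 0
  rw [Matrix.inv_def, Matrix.adjugate_fin_two, Matrix.det_fin_two, Ring.inverse_eq_inv, h10]
  ext i j
  fin_cases i <;> fin_cases j <;> simp <;> ring

theorem contDiffAt_det {y : E2} (hy : y ∈ U) :
    ContDiffAt ℝ ∞ (fun z => g z 0 0 * g z 1 1 - g z 0 1 ^ 2) y :=
  ((hg.smooth y hy 0 0).mul (hg.smooth y hy 1 1)).sub ((hg.smooth y hy 0 1).pow 2)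

theorem contDiffAt_inv {y : E2} (hy : y ∈ U) (i j : Fin 2) :
    ContDiffAt ℝ ∞ (fun z => (g z)⁻¹ i j) y := by
  have hd := hg.contDiffAt_det hy
  have h0 := (hg.det_pos y hy).ne'
  simp only [hg.inv_apply]
  fin_cases i <;> fin_cases j
  · exact (hg.smooth y hy 1 1).div hd h0
  · exact (hg.smooth y hy 0 1).neg.div hd h0
  · exact (hg.smooth y hy 0 1).neg.div hd h0
  · exact (hg.smooth y hy 0 0).div hd h0

theorem contDiffAt_christoffel {y : E2} (hy : y ∈ U) (P M N : Fin 2) :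
    ContDiffAt ℝ ∞ (christoffel g P M N) y := by
  unfold christoffel
  refine contDiffAt_const.mul (ContDiffAt.sum fun L _ => (hg.contDiffAt_inv hy P L).mul ?_)
  exact ((ContDiffAt.pd M (hg.smooth y hy L N)).add (ContDiffAt.pd N (hg.smooth y hy L M))).sub
    (ContDiffAt.pd L (hg.smooth y hy M N))

/-- The Levi-Civita connection is metric. -/
theorem covDeriv_self {y : E2} (hy : y ∈ U) (M N P : Fin 2) : covDeriv g g M N P y = 0 := by
  have hD := mul_inv_cancel₀ (hg.det_pos y hy).ne'
  have h10 : (fun z => g z 1 0) = fun z => g z 0 1 := funext fun z => hg.symm z 1 0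
  have h10' := hg.symm y 1 0
  have hM : ∀ N, (fun z => g z M N) = fun z => g z N M := fun N => funext fun z => hg.symm z M N
  simp only [covDeriv, christoffel, hg.inv_apply, Fin.sum_univ_two, div_eq_mul_inv]
  generalize (g y 0 0 * g y 1 1 - g y 0 1 ^ 2)⁻¹ = d at hD ⊢
  fin_cases N <;> fin_cases P <;>
    simp only [Fin.zero_eta, Fin.mk_one, hM 0, hM 1, h10, h10', Matrix.of_apply, Matrix.cons_val',
      Matrix.cons_val_zero, Matrix.cons_val_one, Matrix.cons_val_fin_one]
  · linear_combination (-pd M (fun z => g z 0 0) y) * hD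
  · linear_combination (-pd M (fun z => g z 0 1) y) * hD
  · linear_combination (-pd M (fun z => g z 0 1) y) * hD
  · linear_combination (-pd M (fun z => g z 1 1) y) * hD

theorem contDiffAt_covDeriv {y : E2} (hy : y ∈ U)
    (hT : ∀ i j, ContDiffAt ℝ ∞ (fun z => T z i j) y) (M N P : Fin 2) :
    ContDiffAt ℝ ∞ (covDeriv g T M N P) y := by
  unfold covDeriv
  exact ((ContDiffAt.pd M (hT N P)).sub
    (ContDiffAt.sum fun L _ => (hg.contDiffAt_christoffel hy L M N).mul (hT L P))).sub
    (ContDiffAt.sum fun L _ => (hg.contDiffAt_christoffel hy L M P).mul (hT N L))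

theorem pd_covDeriv {y : E2} (hy : y ∈ U)
    (hT : ∀ i j, ContDiffAt ℝ ∞ (fun z => T z i j) y) (K M N P : Fin 2) :
    pd K (covDeriv g T M N P) y = pd K (pd M fun z => T z N P) y
      - ∑ L, (pd K (christoffel g L M N) y * T y L P
        + christoffel g L M N y * pd K (fun z => T z L P) y)
      - ∑ L, (pd K (christoffel g L M P) y * T y N L
        + christoffel g L M P y * pd K (fun z => T z N L) y) := by
  have hΓ := fun L M N => (hg.contDiffAt_christoffel hy L M N).diffAt
  have hT' := fun i j => (hT i j).diffAt
  have hm := fun L M N i j => (hΓ L M N).mul (hT' i j)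
  unfold covDeriv
  simp only [Fin.sum_univ_two]
  rw [pd_sub, pd_sub, pd_add, pd_add, pd_mul, pd_mul, pd_mul, pd_mul]
  all_goals first
    | exact hΓ _ _ _
    | exact hT' _ _
    | exact hm _ _ _ _ _
    | exact (hm _ _ _ _ _).add (hm _ _ _ _ _)
    | exact (ContDiffAt.pd M (hT N P)).diffAt
    | exact (ContDiffAt.pd M (hT N P)).diffAt.sub ((hm _ _ _ _ _).add (hm _ _ _ _ _))

/-- The Ricci identity at a point where the covariant derivative vanishes. -/
theorem ricci_identity {y : E2} (hy : y ∈ U)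
    (hT : ∀ i j, ContDiffAt ℝ ∞ (fun z => T z i j) y)
    (h0 : ∀ M N P, covDeriv g T M N P y = 0) (N P : Fin 2) :
    pd 0 (covDeriv g T 1 N P) y - pd 1 (covDeriv g T 0 N P) y
      = - ∑ L, riemann g L N 0 1 y * T y L P - ∑ L, riemann g L P 0 1 y * T y N L := by
  have hd : ∀ M N P, pd M (fun z => T z N P) y =
      ∑ L, christoffel g L M N y * T y L P + ∑ L, christoffel g L M P y * T y N L := by
    intro M N P
    have := h0 M N P
    unfold covDeriv at this
    linarith
  rw [hg.pd_covDeriv hy hT, hg.pd_covDeriv hy hT, pd_comm 1 0 (hT N P)]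
  simp only [hd, riemann, Fin.sum_univ_two]
  ring

end IsMetricOn

/-! ### The curvature of a surface -/

theorem riemann_antisymm (g : E2 → Matrix (Fin 2) (Fin 2) ℝ) (P L M N : Fin 2) (y : E2) :
    riemann g P L M N y = -riemann g P L N M y := by
  simp only [riemann, Fin.sum_univ_two]
  ring

namespace IsMetricOn

variable {g T : E2 → Matrix (Fin 2) (Fin 2) ℝ} {U : Set E2} (hg : IsMetricOn g U)
include hg

theorem pd_eq_zero_of_eqOn_zero {f : E2 → ℝ} (hf : ∀ z ∈ U, f z = 0) {y : E2} (hy : y ∈ U)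
    (M : Fin 2) : pd M f y = 0 := by
  rw [pd_congr M (h := fun _ => 0), pd_const]
  filter_upwards [hg.isOpen.mem_nhds hy] with z hz using hf z hz

/-- In two dimensions the scalar curvature determines the Riemann tensor. -/
theorem riemann_eq {y : E2} (hy : y ∈ U) :
    riemann g 0 0 0 1 y = scalarCurv g y / 2 * g y 0 1 ∧
    riemann g 1 0 0 1 y = -(scalarCurv g y / 2 * g y 0 0) ∧
    riemann g 0 1 0 1 y = scalarCurv g y / 2 * g y 1 1 ∧
    riemann g 1 1 0 1 y = -(scalarCurv g y / 2 * g y 0 1) := by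
  have hD := hg.det_pos y hy
  have hR : scalarCurv g y * (g y 0 0 * g y 1 1 - g y 0 1 ^ 2) =
      - g y 1 1 * riemann g 1 0 0 1 y - g y 0 1 * (riemann g 0 0 0 1 y - riemann g 1 1 0 1 y)
        + g y 0 0 * riemann g 0 1 0 1 y := by
    have e0 : ∀ P L M, riemann g P L M M y = 0 := fun P L M => by
      linarith [riemann_antisymm g P L M M y]
    simp only [scalarCurv, ricci, hg.inv_apply, Fin.sum_univ_two, e0, riemann_antisymm g _ _ 1 0,
      div_eq_mul_inv, Matrix.of_apply, Matrix.cons_val', Matrix.cons_val_zero, Matrix.cons_val_one,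
      Matrix.cons_val_fin_one]
    linear_combination (- g y 1 1 * riemann g 1 0 0 1 y
      - g y 0 1 * (riemann g 0 0 0 1 y - riemann g 1 1 0 1 y)
      + g y 0 0 * riemann g 0 1 0 1 y) * mul_inv_cancel₀ hD.ne'
  -- The Ricci identity for the parallel tensor `g` says that the Riemann tensor with lowered index
  -- is antisymmetric in its first pair, so one independent component remains.
  have hs : ∀ N P, - ∑ L, riemann g L N 0 1 y * g y L P - ∑ L, riemann g L P 0 1 y * g y N L
      = 0 := by
    intro N P
    rw [← hg.ricci_identity hy (hg.smooth y hy) (hg.covDeriv_self hy),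
      hg.pd_eq_zero_of_eqOn_zero (fun z hz => hg.covDeriv_self hz _ _ _) hy,
      hg.pd_eq_zero_of_eqOn_zero (fun z hz => hg.covDeriv_self hz _ _ _) hy, sub_zero]
  have h00 := hs 0 0
  have h01 := hs 0 1
  have h11 := hs 1 1
  have h10 := hg.symm y 1 0
  simp only [Fin.sum_univ_two, h10] at h00 h01 h11
  generalize riemann g 0 0 0 1 y = r00 at *
  generalize riemann g 1 0 0 1 y = r10 at *
  generalize riemann g 0 1 0 1 y = r01 at *
  generalize riemann g 1 1 0 1 y = r11 at *
  generalize scalarCurv g y = R at *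
  generalize g y 0 0 = E at *
  generalize g y 0 1 = F at *
  generalize g y 1 1 = G at *
  -- The right side is twice the lowered component `R_0101`.
  have hρ : R * (E * G - F ^ 2) = 2 * (E * r01 + F * r11) := by
    linear_combination hR + h01
  refine ⟨mul_right_cancel₀ hD.ne' ?_, mul_right_cancel₀ hD.ne' ?_,
    mul_right_cancel₀ hD.ne' ?_, mul_right_cancel₀ hD.ne' ?_⟩
  · linear_combination (-F / 2) * hρ - G / 2 * h00 + F * h01
  · linear_combination (E / 2) * hρ + F / 2 * h00 - E * h01
  · linear_combination (-G / 2) * hρ + F / 2 * h11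
  · linear_combination (F / 2) * hρ - E / 2 * h11

/-! ### Trace-free Codazzi tensors in a coordinate domain -/

omit hg in
theorem covDeriv_symm (hTs : ∀ y i j, T y i j = T y j i) (M N P : Fin 2) (y : E2) :
    covDeriv g T M N P y = covDeriv g T M P N y := by
  have h : (fun z => T z N P) = fun z => T z P N := funext fun z => hTs z N P
  simp only [covDeriv, h, hTs y _ P, hTs y N]
  ring

omit hg in
theorem pd_eq_covDeriv_add (M N P : Fin 2) (y : E2) :
    pd M (fun z => T z N P) y = covDeriv g T M N P y +
      (christoffel g 0 M N y * T y 0 P + christoffel g 1 M N y * T y 1 P) +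
      (christoffel g 0 M P y * T y N 0 + christoffel g 1 M P y * T y N 1) := by
  simp only [covDeriv, Fin.sum_univ_two]
  ring

theorem pd_self {y : E2} (hy : y ∈ U) (M N P : Fin 2) :
    pd M (fun z => g z N P) y =
      (christoffel g 0 M N y * g y 0 P + christoffel g 1 M N y * g y 1 P) +
      (christoffel g 0 M P y * g y N 0 + christoffel g 1 M P y * g y N 1) := by
  rw [pd_eq_covDeriv_add, hg.covDeriv_self hy, zero_add]

variable (hT : ∀ y ∈ U, ∀ i j, ContDiffAt ℝ ∞ (fun z => T z i j) y)
  (hTs : ∀ y i j, T y i j = T y j i)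
  (htr : ∀ y ∈ U, g y 1 1 * T y 0 0 - 2 * (g y 0 1 * T y 0 1) + g y 0 0 * T y 1 1 = 0)
include hT hTs htr

/-- The hypothesis `htr` is the trace multiplied by `det g`. Differentiating it produces the trace
of `DT` and a multiple of `htr` itself, because `∂_M det g = 2 Γ^L_ML det g`. -/
theorem trace_covDeriv {y : E2} (hy : y ∈ U) (M : Fin 2) :
    g y 1 1 * covDeriv g T M 0 0 y - 2 * (g y 0 1 * covDeriv g T M 0 1 y)
      + g y 0 0 * covDeriv g T M 1 1 y = 0 := by
  have hgd := fun i j => (hg.smooth y hy i j).diffAt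
  have hTd := fun i j => (hT y hy i j).diffAt
  have h := hg.pd_eq_zero_of_eqOn_zero htr hy M
  rw [pd_add M (((hgd 1 1).fun_mul (hTd 0 0)).fun_sub (((hgd 0 1).fun_mul (hTd 0 1)).const_mul 2))
      ((hgd 0 0).fun_mul (hTd 1 1)),
    pd_sub M ((hgd 1 1).fun_mul (hTd 0 0)) (((hgd 0 1).fun_mul (hTd 0 1)).const_mul 2),
    pd_const_mul M 2 ((hgd 0 1).fun_mul (hTd 0 1)), pd_mul M (hgd 1 1) (hTd 0 0),
    pd_mul M (hgd 0 1) (hTd 0 1), pd_mul M (hgd 0 0) (hTd 1 1)] at h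
  simp only [hg.pd_self hy, pd_eq_covDeriv_add (g := g) (T := T), hg.symm y 1 0, hTs y 1 0] at h
  linear_combination h - 2 * (christoffel g 0 M 0 y + christoffel g 1 M 1 y) * htr y hy

omit hTs htr in
theorem contDiffAt_det_quotient {y : E2} (hy : y ∈ U) :
    ContDiffAt ℝ ∞
      (fun z => (T z 0 1 ^ 2 - T z 0 0 * T z 1 1) / (g z 0 0 * g z 1 1 - g z 0 1 ^ 2)) y :=
  (((hT y hy 0 1).pow 2).sub ((hT y hy 0 0).mul (hT y hy 1 1))).div (hg.contDiffAt_det hy)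
    (hg.det_pos y hy).ne'

omit htr in
/-- The derivative of the quotient `-det T / det g`, in terms of the covariant derivative of `T`. -/
theorem pd_det_quotient {y : E2} (hy : y ∈ U) (M : Fin 2) :
    pd M (fun z => (T z 0 1 ^ 2 - T z 0 0 * T z 1 1) / (g z 0 0 * g z 1 1 - g z 0 1 ^ 2)) y
      * (g y 0 0 * g y 1 1 - g y 0 1 ^ 2) =
      2 * (T y 0 1 * covDeriv g T M 0 1 y) - T y 1 1 * covDeriv g T M 0 0 y
        - T y 0 0 * covDeriv g T M 1 1 y := by
  have hgd := fun i j => (hg.smooth y hy i j).diffAt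
  have hTd := fun i j => (hT y hy i j).diffAt
  have hD := (hg.det_pos y hy).ne'
  set D := fun z => g z 0 0 * g z 1 1 - g z 0 1 * g z 0 1 with hDdef
  set f := fun z => (T z 0 1 ^ 2 - T z 0 0 * T z 1 1) / (g z 0 0 * g z 1 1 - g z 0 1 ^ 2) with hf
  have hdD : DifferentiableAt ℝ D y :=
    ((hgd 0 0).fun_mul (hgd 1 1)).fun_sub ((hgd 0 1).fun_mul (hgd 0 1))
  have hdf : DifferentiableAt ℝ f y :=
    (hg.contDiffAt_det_quotient hT hy).diffAt
  -- Differentiating the product `f · det g = -det T` avoids the quotient rule. The connection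
  -- contributes the same factor `2 Γ^L_ML` to the derivatives of both determinants, so it cancels.
  have hfD : ∀ z ∈ U, f z * D z = T z 0 1 * T z 0 1 - T z 0 0 * T z 1 1 := by
    intro z hz
    have := mul_inv_cancel₀ (hg.det_pos z hz).ne'
    simp only [hf, hDdef, div_eq_mul_inv]
    linear_combination (T z 0 1 ^ 2 - T z 0 0 * T z 1 1) * this
  have h := pd_congr M (Filter.eventuallyEq_of_mem (hg.isOpen.mem_nhds hy) hfD)
  rw [pd_mul M hdf hdD, pd_sub M ((hTd 0 1).fun_mul (hTd 0 1)) ((hTd 0 0).fun_mul (hTd 1 1)),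
    pd_mul M (hTd 0 1) (hTd 0 1), pd_mul M (hTd 0 0) (hTd 1 1), hDdef,
    pd_sub M ((hgd 0 0).fun_mul (hgd 1 1)) ((hgd 0 1).fun_mul (hgd 0 1)),
    pd_mul M (hgd 0 0) (hgd 1 1), pd_mul M (hgd 0 1) (hgd 0 1)] at h
  have hfy := hfD y hy
  simp only [hg.pd_self hy, pd_eq_covDeriv_add (g := g) (T := T), hg.symm y 1 0, hTs y 1 0] at h
  simp only [hDdef] at hfy
  linear_combination h - 2 * (christoffel g 0 M 0 y + christoffel g 1 M 1 y) * hfy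

/-- A critical point of `-det T / det g` with a positive value is a zero of the covariant
derivative. -/
theorem covDeriv_eq_zero_of_critical
    (hC : ∀ y ∈ U, ∀ M N P, covDeriv g T M N P y = covDeriv g T N M P y)
    {y : E2} (hy : y ∈ U) (hpos : 0 < T y 0 1 ^ 2 - T y 0 0 * T y 1 1)
    (hcrit : ∀ M, pd M
      (fun z => (T z 0 1 ^ 2 - T z 0 0 * T z 1 1) / (g z 0 0 * g z 1 1 - g z 0 1 ^ 2)) y = 0) :
    ∀ M N P, covDeriv g T M N P y = 0 := by
  have hs := fun M N P => covDeriv_symm (g := g) hTs M N P y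
  have hc := hC y hy
  have tr0 := hg.trace_covDeriv hT hTs htr hy 0
  have tr1 := hg.trace_covDeriv hT hTs htr hy 1
  have c0 := hg.pd_det_quotient hT hTs hy 0
  have c1 := hg.pd_det_quotient hT hTs hy 1
  rw [hcrit, zero_mul] at c0 c1
  -- Total symmetry of `DT` leaves four components `t0, …, t3`; the two trace equations determine
  -- `t2` and `t3` from `t0` and `t1`.
  have e100 : covDeriv g T 1 0 0 y = covDeriv g T 0 0 1 y := by rw [hc 1 0 0, hs 0 1 0]
  have e101 : covDeriv g T 1 0 1 y = covDeriv g T 0 1 1 y := by rw [hc 1 0 1]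
  rw [e100, e101] at tr1 c1
  have htr := htr y hy
  have hE := hg.pos y hy
  have hD := hg.det_pos y hy
  have h010 := hs 0 1 0
  have h110 := hs 1 1 0
  generalize e0 : covDeriv g T 0 0 0 y = t0 at *
  generalize e1 : covDeriv g T 0 0 1 y = t1 at *
  generalize e2 : covDeriv g T 0 1 1 y = t2 at *
  generalize e3 : covDeriv g T 1 1 1 y = t3 at *
  generalize g y 0 0 = E at *
  generalize g y 0 1 = F at *
  generalize g y 1 1 = G at *
  generalize T y 0 0 = a at *
  generalize T y 0 1 = b at *
  generalize T y 1 1 = c at *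
  -- For trace-free `T` this is the determinant of the linear system `p0`, `p1` in `t0`, `t1`.
  have hQ : 0 < E * (E * G - F ^ 2) * (b ^ 2 - a * c) := by positivity
  have p0 : (a * G - F * b) * t0 + (b * E - a * F) * t1 = 0 := by
    linear_combination (-E / 2) * c0 + a / 2 * tr0 + t0 / 2 * htr
  have p1 : -(b * E - a * F) * G * t0 + (2 * F * (b * E - a * F) + E * (a * G - F * b)) * t1
      = 0 := by
    linear_combination (-E ^ 2 / 2) * c1 + E * a / 2 * tr1 + E * t1 / 2 * htr
      - (b * E - a * F) * tr0
  have z0 : t0 = 0 := by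
    refine (mul_eq_zero.1 ?_).resolve_left hQ.ne'
    linear_combination (2 * F * (b * E - a * F) + E * (a * G - F * b)) * p0 - (b * E - a * F) * p1
      - (E * G - F ^ 2) * a * t0 * htr
  have z1 : t1 = 0 := by
    refine (mul_eq_zero.1 ?_).resolve_left hQ.ne'
    linear_combination (b * E - a * F) * G * p0 + (a * G - F * b) * p1
      - (E * G - F ^ 2) * a * t1 * htr
  have z2 : t2 = 0 := by
    refine (mul_eq_zero.1 ?_).resolve_left hE.ne'
    linear_combination tr0 - G * z0 + 2 * F * z1
  have z3 : t3 = 0 := by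
    refine (mul_eq_zero.1 ?_).resolve_left hE.ne'
    linear_combination tr1 - G * z1 + 2 * F * z2
  simp only [Fin.forall_fin_two]
  exact ⟨⟨⟨e0.trans z0, e1.trans z1⟩, ⟨h010.trans z1, e2.trans z2⟩⟩,
    ⟨⟨e100.trans z1, e101.trans z2⟩, ⟨h110.trans (e101.trans z2), e3.trans z3⟩⟩⟩

/-- The maximum principle for trace-free Codazzi tensors on a surface of positive curvature. -/
theorem det_nonneg_of_isLocalMax
    (hC : ∀ y ∈ U, ∀ M N P, covDeriv g T M N P y = covDeriv g T N M P y)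
    {y : E2} (hy : y ∈ U) (hR : 0 < scalarCurv g y)
    (hmax : IsLocalMax
      (fun z => (T z 0 1 ^ 2 - T z 0 0 * T z 1 1) / (g z 0 0 * g z 1 1 - g z 0 1 ^ 2)) y) :
    T y 0 1 ^ 2 - T y 0 0 * T y 1 1 ≤ 0 := by
  by_contra! hpos
  have h0 := hg.covDeriv_eq_zero_of_critical hT hTs htr hC hy hpos
    (pd_eq_zero_of_isLocalMax hmax)
  have hcrit := pd_eq_zero_of_isLocalMax hmax
  have hfs := hg.contDiffAt_det_quotient hT hy
  have hcomm := pd_comm 0 1 hfs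
  have hess := hessian_nonpos_of_isLocalMax hfs hmax
  set f := fun z => (T z 0 1 ^ 2 - T z 0 0 * T z 1 1) / (g z 0 0 * g z 1 1 - g z 0 1 ^ 2) with hf
  have hTd := fun i j => (hT y hy i j).diffAt
  have htd := fun M N P => (hg.contDiffAt_covDeriv (T := T) hy (hT y hy) M N P).diffAt
  -- the second derivatives of `f`
  have hff : ∀ L M, pd L (pd M f) y * (g y 0 0 * g y 1 1 - g y 0 1 ^ 2) =
      2 * (T y 0 1 * pd L (covDeriv g T M 0 1) y) - T y 1 1 * pd L (covDeriv g T M 0 0) y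
        - T y 0 0 * pd L (covDeriv g T M 1 1) y := by
    intro L M
    have h := pd_congr L (Filter.eventuallyEq_of_mem (hg.isOpen.mem_nhds hy)
      fun z hz => hg.pd_det_quotient hT hTs hz M)
    rw [pd_mul L (ContDiffAt.pd M hfs).diffAt (hg.contDiffAt_det hy).diffAt, hcrit, zero_mul,
      add_zero] at h
    have hm := fun i j N P => (hTd i j).fun_mul (htd M N P)
    rw [pd_sub L (((hm 0 1 0 1).const_mul 2).fun_sub (hm 1 1 0 0)) (hm 0 0 1 1),
      pd_sub L ((hm 0 1 0 1).const_mul 2) (hm 1 1 0 0), pd_const_mul L 2 (hm 0 1 0 1),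
      pd_mul L (hTd 0 1) (htd M 0 1), pd_mul L (hTd 1 1) (htd M 0 0),
      pd_mul L (hTd 0 0) (htd M 1 1)] at h
    -- Since `DT = 0` at `y`, only derivatives of `DT` survive, and there they coincide with second
    -- covariant derivatives.
    simp only [h0, mul_zero, zero_add] at h
    exact h
  -- the symmetries of the second covariant derivative
  have hsym : ∀ L M N P, pd L (covDeriv g T M N P) y = pd L (covDeriv g T M P N) y :=
    fun L M N P => congrArg (fun φ => pd L φ y) (funext (covDeriv_symm hTs M N P))
  have hcod : ∀ L M N P, pd L (covDeriv g T M N P) y = pd L (covDeriv g T N M P) y :=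
    fun L M N P => pd_congr L (Filter.eventuallyEq_of_mem (hg.isOpen.mem_nhds hy)
      fun z hz => hC z hz M N P)
  have htr' : ∀ L M, g y 1 1 * pd L (covDeriv g T M 0 0) y
      - 2 * (g y 0 1 * pd L (covDeriv g T M 0 1) y)
      + g y 0 0 * pd L (covDeriv g T M 1 1) y = 0 := by
    intro L M
    have hgd := fun i j => (hg.smooth y hy i j).diffAt
    have h := hg.pd_eq_zero_of_eqOn_zero (fun z hz => hg.trace_covDeriv hT hTs htr hz M) hy L
    have hm := fun i j N P => (hgd i j).fun_mul (htd M N P)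
    rw [pd_add L ((hm 1 1 0 0).fun_sub ((hm 0 1 0 1).const_mul 2)) (hm 0 0 1 1),
      pd_sub L (hm 1 1 0 0) ((hm 0 1 0 1).const_mul 2), pd_const_mul L 2 (hm 0 1 0 1),
      pd_mul L (hgd 0 1) (htd M 0 1), pd_mul L (hgd 1 1) (htd M 0 0),
      pd_mul L (hgd 0 0) (htd M 1 1)] at h
    simp only [h0, mul_zero, zero_add] at h
    exact h
  -- the Ricci identity
  obtain ⟨r00, r10, r01, r11⟩ := hg.riemann_eq hy
  have hric := fun N P => hg.ricci_identity hy (hT y hy) h0 N P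
  simp only [Fin.sum_univ_two] at hric
  have ric0 := hric 0 0
  have ric1 := hric 0 1
  have ric2 := hric 1 1
  have tr00 := htr' 0 0
  have tr01 := htr' 0 1
  have tr10 := htr' 1 0
  have tr11 := htr' 1 1
  have f00 := hff 0 0
  have f01 := hff 0 1
  have f10 := hff 1 0
  have f11 := hff 1 1
  have e : ∀ L, pd L (covDeriv g T 1 0 0) y = pd L (covDeriv g T 0 0 1) y := fun L => by
    rw [hcod L 1 0 0, hsym L 0 1 0]
  have e' : ∀ L, pd L (covDeriv g T 1 0 1) y = pd L (covDeriv g T 0 1 1) y := fun L => by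
    rw [hcod L 1 0 1]
  rw [hcomm] at f01
  simp only [e, e', r00, r10, r01, r11, hTs y 1 0] at ric0 ric1 ric2 tr01 tr11 f01 f11 f00 f10
  have htr := htr y hy
  have hD := hg.det_pos y hy
  -- The directions `∂_0` and `-F ∂_0 + E ∂_1` are orthogonal. They decompose `E (G h00 - 2F h10 + E
  -- h11)` as `(EG - F²) h00` plus the Hessian in the second direction.
  have hess0 := hess 1 0
  have hess1 := hess (-g y 0 1) (g y 0 0)
  rw [hcomm] at hess1 hess0
  have hE := hg.pos y hy
  generalize pd 0 (covDeriv g T 0 0 0) y = s00 at *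
  generalize pd 0 (covDeriv g T 0 0 1) y = s01 at *
  generalize pd 0 (covDeriv g T 0 1 1) y = s02 at *
  generalize pd 0 (covDeriv g T 1 1 1) y = s03 at *
  generalize pd 1 (covDeriv g T 0 0 0) y = s10 at *
  generalize pd 1 (covDeriv g T 0 0 1) y = s11 at *
  generalize pd 1 (covDeriv g T 0 1 1) y = s12 at *
  generalize pd 1 (covDeriv g T 1 1 1) y = s13 at *
  generalize pd 0 (pd 0 f) y = h00 at *
  generalize pd 1 (pd 0 f) y = h10 at *
  generalize pd 1 (pd 1 f) y = h11 at *
  generalize g y 0 0 = E at *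
  generalize g y 0 1 = F at *
  generalize g y 1 1 = G at *
  generalize T y 0 0 = a at *
  generalize T y 0 1 = b at *
  generalize T y 1 1 = c at *
  generalize scalarCurv g y = R at *
  -- This is `Δf = 2 R f` multiplied by `det g`; the Christoffel terms of the Laplacian drop out
  -- because `df = 0`.
  have hΔ : G * h00 - 2 * F * h10 + E * h11 = 2 * R * (b ^ 2 - a * c) := by
    refine mul_right_cancel₀ hD.ne' ?_
    linear_combination G * f00 - F * f01 - F * f10 + E * f11
      + 2 * b * (tr01 + F * ric1 - E * ric2) - c * (tr00 + F * ric0 - E * ric1)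
      - a * (tr11 + G * ric1 - F * ric2) - R / 2 * (2 * b * F - c * E - a * G) * htr
  have hΔpos : 0 < E * (2 * R * (b ^ 2 - a * c)) := by positivity
  nlinarith [mul_nonneg hD.le (show 0 ≤ -h00 by linarith)]

end IsMetricOn

/-! ### Components of tensors in charts of the sphere -/

theorem contMDiff_constSection (v : E2) :
    ContMDiff (𝓡 2) (𝓡 2).tangent ∞ fun y : E2 => (⟨y, v⟩ : TangentBundle (𝓡 2) E2) := by
  intro y
  rw [Bundle.contMDiffAt_totalSpace]
  refine ⟨contMDiffAt_id, ?_⟩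
  simp [contMDiffAt_const]

theorem contMDiffOn_coordVec {e : OpenPartialHomeomorph Sph E2} (he : IsChart e) (M : Fin 2) :
    ContMDiffOn (𝓡 2) (𝓡 2).tangent ∞
      (fun y => (⟨e.symm y, coordVec e y M⟩ : TangentBundle (𝓡 2) Sph)) e.target := by
  have h1 := contMDiffOn_symm_of_mem_maximalAtlas he
  have h2 := h1.contMDiffOn_tangentMapWithin (m := ∞) (by simp) e.open_target.uniqueMDiffOn
  have h3 := h2.comp (contMDiff_constSection (EuclideanSpace.single M (1 : ℝ))).contMDiffOn
    (s := e.target) (fun y hy => hy)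
  refine h3.congr fun y hy => ?_
  simp only [Function.comp, tangentMapWithin, coordVec,
    mfderivWithin_of_isOpen e.open_target hy]

theorem contDiffOn_comp_metric (q : Metric2) {e : OpenPartialHomeomorph Sph E2} (he : IsChart e)
    (M N : Fin 2) : ContDiffOn ℝ ∞ (fun y => comp q.inner e y M N) e.target := by
  have hq : ContMDiffOn (𝓡 2) ((𝓡 2).prod 𝓘(ℝ, E2 →L[ℝ] E2 →L[ℝ] ℝ)) ∞
      (fun y => Bundle.TotalSpace.mk' (E2 →L[ℝ] E2 →L[ℝ] ℝ)
        (E := fun x : Sph => TangentSpace (𝓡 2) x →L[ℝ] TangentSpace (𝓡 2) x →L[ℝ] ℝ)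
        (e.symm y) (q.inner (e.symm y))) e.target :=
    q.contMDiff.comp_contMDiffOn (contMDiffOn_symm_of_mem_maximalAtlas he)
  have h := ContMDiffOn.clm_bundle_apply₂ (F₁ := E2) (F₂ := E2) (F₃ := ℝ)
    (E₃ := fun _ : Sph => ℝ) hq (contMDiffOn_coordVec he M) (contMDiffOn_coordVec he N)
  intro y hy
  have h' := h y hy
  rw [Bundle.contMDiffWithinAt_totalSpace] at h'
  exact h'.2.contDiffWithinAt

theorem bilin_apply_eq_sum (B : E2 →L[ℝ] E2 →L[ℝ] ℝ) (v w : E2) :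
    B v w = ∑ i, ∑ j, v i * w j *
      B (EuclideanSpace.single i (1 : ℝ)) (EuclideanSpace.single j (1 : ℝ)) := by
  have hv : ∀ v : E2, v = ∑ i, v i • (EuclideanSpace.single i (1 : ℝ) : E2) := fun v => by
    ext k
    fin_cases k <;> simp
  conv_lhs => rw [hv v, hv w]
  simp only [map_sum, sum_apply, map_smul, smul_apply, smul_eq_mul, Finset.mul_sum]
  rw [Finset.sum_comm]
  exact Finset.sum_congr rfl fun i _ => Finset.sum_congr rfl fun j _ => by ring

/-- The differential of the inverse of a chart is injective. -/
theorem mfderiv_symm_injective {e : OpenPartialHomeomorph Sph E2} (he : IsChart e) {y : E2}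
    (hy : y ∈ e.target) : Function.Injective (mfderiv (𝓡 2) (𝓡 2) e.symm y) := by
  have hm : e.MDifferentiable (𝓡 2) (𝓡 2) :=
    ⟨(contMDiffOn_of_mem_maximalAtlas he).mdifferentiableOn (by simp),
      (contMDiffOn_symm_of_mem_maximalAtlas he).mdifferentiableOn (by simp)⟩
  exact hm.symm.mfderiv_injective hy

theorem coordVec_combination (e : OpenPartialHomeomorph Sph E2) (y : E2) (a b : ℝ) :
    a • coordVec e y 0 + b • coordVec e y 1 =
      mfderiv (𝓡 2) (𝓡 2) e.symm y
        (a • EuclideanSpace.single 0 (1 : ℝ) + b • EuclideanSpace.single 1 (1 : ℝ) : E2) := by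
  simp only [coordVec]
  erw [map_add, map_smul, map_smul]

theorem coordVec_independent {e : OpenPartialHomeomorph Sph E2} (he : IsChart e) {y : E2}
    (hy : y ∈ e.target) {a b : ℝ} (h : a • coordVec e y 0 + b • coordVec e y 1 = 0) :
    a = 0 ∧ b = 0 := by
  rw [coordVec_combination] at h
  have h0 : (a • EuclideanSpace.single 0 (1 : ℝ) + b • EuclideanSpace.single 1 (1 : ℝ) : E2) = 0 :=
    mfderiv_symm_injective he hy (h.trans (map_zero _).symm)
  constructor
  · simpa using congrArg (fun v : E2 => v 0) h0
  · simpa using congrArg (fun v : E2 => v 1) h0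

theorem isMetricOn_comp (q : Metric2) {e : OpenPartialHomeomorph Sph E2} (he : IsChart e) :
    IsMetricOn (comp q.inner e) e.target where
  isOpen := e.open_target
  smooth y hy i j := (contDiffOn_comp_metric q he i j).contDiffAt (e.open_target.mem_nhds hy)
  symm y i j := q.symm _ _ _
  pos y hy := q.pos _ _ fun h => by
    have := (coordVec_independent he hy (a := 1) (b := 0) (by simp [h])).1
    simp at this
  det_pos y hy := by
    have hE : 0 < comp q.inner e y 0 0 := q.pos _ _ fun h => by
      have := (coordVec_independent he hy (a := 1) (b := 0) (by simp [h])).1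
      simp at this
    -- This vector is orthogonal to `∂_0`, and its squared length is `g_00 · det g`.
    have h := q.pos (e.symm y)
      ((-comp q.inner e y 0 1) • coordVec e y 0 + comp q.inner e y 0 0 • coordVec e y 1)
      fun h => hE.ne' (coordVec_independent he hy h).2
    have hs : comp q.inner e y 1 0 = comp q.inner e y 0 1 := q.symm _ _ _
    have hx : ∀ a b : ℝ, q.inner (e.symm y) (a • coordVec e y 0 + b • coordVec e y 1)
        (a • coordVec e y 0 + b • coordVec e y 1) =
        a * (a * comp q.inner e y 0 0 + b * comp q.inner e y 0 1) +
        b * (a * comp q.inner e y 1 0 + b * comp q.inner e y 1 1) := by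
      intro a b
      simp only [map_add, map_smul, add_apply, smul_apply, smul_eq_mul]
      simp only [comp, Matrix.of_apply]
      ring
    rw [hx, hs] at h
    refine pos_of_mul_pos_right (a := comp q.inner e y 0 0) ?_ hE.le
    linarith

/-- The matrix of a tensor in the standard frame of the model space. -/
def gram (T : Tensor2) (x : Sph) : Matrix (Fin 2) (Fin 2) ℝ :=
  Matrix.of fun i j => (show E2 →L[ℝ] E2 →L[ℝ] ℝ from T x)
    (EuclideanSpace.single i (1 : ℝ)) (EuclideanSpace.single j (1 : ℝ))

/-- The matrix of the coordinate frame in the standard frame of the model space. -/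
def frame (e : OpenPartialHomeomorph Sph E2) (y : E2) : Matrix (Fin 2) (Fin 2) ℝ :=
  Matrix.of fun i M => (show E2 from coordVec e y M) i

theorem comp_eq_gram (T : Tensor2) (e : OpenPartialHomeomorph Sph E2) (y : E2) :
    comp T e y = (frame e y).transpose * gram T (e.symm y) * frame e y := by
  ext M N
  have h := bilin_apply_eq_sum (show E2 →L[ℝ] E2 →L[ℝ] ℝ from T (e.symm y))
    (coordVec e y M) (coordVec e y N)
  refine h.trans ?_
  simp only [Matrix.mul_apply, Fin.sum_univ_two, Matrix.transpose_apply, frame, gram,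
    Matrix.of_apply]
  ring

theorem frame_det_ne_zero {e : OpenPartialHomeomorph Sph E2} (he : IsChart e) {y : E2}
    (hy : y ∈ e.target) : (frame e y).det ≠ 0 := by
  intro h
  obtain ⟨v, hv, hv0⟩ := Matrix.exists_mulVec_eq_zero_iff.2 h
  have h0 : v 0 • coordVec e y 0 + v 1 • coordVec e y 1 = 0 := by
    have h1 : (v 0 • (show E2 from coordVec e y 0) + v 1 • (show E2 from coordVec e y 1) : E2)
        = 0 := by
      ext i
      have := congrFun hv0 i
      simp only [Matrix.mulVec, dotProduct, Fin.sum_univ_two, frame, Matrix.of_apply,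
        Pi.zero_apply] at this
      change v 0 * (show E2 from coordVec e y 0) i + v 1 * (show E2 from coordVec e y 1) i = 0
      linarith
    exact h1
  obtain ⟨h1, h2⟩ := coordVec_independent he hy h0
  exact hv (by ext i; fin_cases i <;> simp [h1, h2])

theorem det_comp (T : Tensor2) (e : OpenPartialHomeomorph Sph E2) (y : E2) :
    (comp T e y).det = (frame e y).det ^ 2 * (gram T (e.symm y)).det := by
  rw [comp_eq_gram, Matrix.det_mul, Matrix.det_mul, Matrix.det_transpose]
  ring

/-- Minus the determinant of `T` relative to that of `q`; for trace-free `T` it is half the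
squared norm. -/
def negDet (q : Metric2) (T : Tensor2) (x : Sph) : ℝ :=
  -(gram T x).det / (gram q.inner x).det

/-- Both determinants acquire the factor `(det frame)²` under the change of frame, so the quotient
is the same in every chart. -/
theorem negDet_symm_apply (q : Metric2) {T : Tensor2} (hT : ∀ x v w, T x v w = T x w v)
    {e : OpenPartialHomeomorph Sph E2} (he : IsChart e) {y : E2} (hy : y ∈ e.target) :
    negDet q T (e.symm y) = (comp T e y 0 1 ^ 2 - comp T e y 0 0 * comp T e y 1 1) /
      (comp q.inner e y 0 0 * comp q.inner e y 1 1 - comp q.inner e y 0 1 ^ 2) := by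
  have h1 := det_comp T e y
  have h2 := det_comp q.inner e y
  have hf := pow_ne_zero 2 (frame_det_ne_zero he hy)
  have s1 : comp T e y 1 0 = comp T e y 0 1 := hT _ _ _
  have s2 := (isMetricOn_comp q he).symm y 1 0
  rw [Matrix.det_fin_two, s1] at h1
  rw [Matrix.det_fin_two, s2] at h2
  have e1 : comp T e y 0 1 ^ 2 - comp T e y 0 0 * comp T e y 1 1 =
      (frame e y).det ^ 2 * -(gram T (e.symm y)).det := by linarith
  have e2 : comp q.inner e y 0 0 * comp q.inner e y 1 1 - comp q.inner e y 0 1 ^ 2 =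
      (frame e y).det ^ 2 * (gram q.inner (e.symm y)).det := by linarith
  rw [e1, e2, mul_div_mul_left _ _ hf, negDet]

theorem eq_zero_of_comp_eq_zero {T : Tensor2} {e : OpenPartialHomeomorph Sph E2} (he : IsChart e)
    {x : Sph} (hx : x ∈ e.source) (h : comp T e (e x) = 0) : T x = 0 := by
  have hf := frame_det_ne_zero he (e.map_source hx)
  rw [comp_eq_gram, e.left_inv hx] at h
  have hu : IsUnit (frame e (e x)) := (Matrix.isUnit_iff_isUnit_det _).2 hf.isUnit
  have hu' : IsUnit (frame e (e x)).transpose := by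
    rw [Matrix.isUnit_iff_isUnit_det, Matrix.det_transpose]; exact hf.isUnit
  have h0 : gram T x = 0 := by
    rw [hu.mul_left_eq_zero, hu'.mul_right_eq_zero] at h
    exact h
  have h1 : (show E2 →L[ℝ] E2 →L[ℝ] ℝ from T x) = 0 := by
    ext v w
    rw [bilin_apply_eq_sum]
    refine Finset.sum_eq_zero fun i _ => Finset.sum_eq_zero fun j _ => ?_
    have : gram T x i j = 0 := by rw [h0]; rfl
    exact mul_eq_zero_of_right _ this
  exact h1

/-! ### Vanishing of trace-free Codazzi tensors on the sphere -/

/-- A symmetric matrix which is trace-free and of nonnegative determinant with respect to a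
positive definite one vanishes. -/
theorem eq_zero_of_trace_det {E F G a b c : ℝ} (hE : 0 < E) (hD : 0 < E * G - F ^ 2)
    (htr : G * a - 2 * (F * b) + E * c = 0) (hdet : b ^ 2 - a * c ≤ 0) :
    a = 0 ∧ b = 0 ∧ c = 0 := by
  have h : (E * b - F * a) ^ 2 + (E * G - F ^ 2) * a ^ 2 ≤ 0 := by
    have : (E * b - F * a) ^ 2 + (E * G - F ^ 2) * a ^ 2 = E ^ 2 * (b ^ 2 - a * c) := by
      linear_combination (E * a) * htr
    rw [this]
    exact mul_nonpos_of_nonneg_of_nonpos (sq_nonneg E) hdet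
  have ha2 : a ^ 2 = 0 := by
    refine le_antisymm ?_ (sq_nonneg a)
    by_contra! hlt
    nlinarith [mul_pos hD hlt, sq_nonneg (E * b - F * a)]
  have ha : a = 0 := pow_eq_zero_iff two_ne_zero |>.1 ha2
  subst ha
  have hb : b = 0 := by
    have : (E * b) ^ 2 = 0 := le_antisymm (by linarith) (sq_nonneg _)
    simpa [hE.ne'] using this
  subst hb
  refine ⟨rfl, rfl, ?_⟩
  simpa [hE.ne'] using htr

/-- On the sphere with a metric of positive constant scalar curvature, a smooth symmetric
trace-free Codazzi tensor vanishes. -/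
theorem eq_zero_of_codazzi (q : Metric2) {R : ℝ} (hR : 0 < R) (hq : HasScalarCurvature q R)
    {T : Tensor2} (hsmooth : ∀ e, IsChart e → ∀ y ∈ e.target, ∀ i j,
      ContDiffAt ℝ ∞ (fun z => comp T e z i j) y)
    (hsymm : ∀ x v w, T x v w = T x w v)
    (htr : ∀ e, IsChart e → ∀ y ∈ e.target,
      comp q.inner e y 1 1 * comp T e y 0 0 - 2 * (comp q.inner e y 0 1 * comp T e y 0 1)
        + comp q.inner e y 0 0 * comp T e y 1 1 = 0)
    (hC : ∀ e, IsChart e → ∀ y ∈ e.target, ∀ M N P,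
      covDeriv (comp q.inner e) (comp T e) M N P y = covDeriv (comp q.inner e) (comp T e) N M P y)
    (x : Sph) : T x = 0 := by
  have hchart : ∀ x : Sph, IsChart (chartAt E2 x) := fun x =>
    IsManifold.chart_mem_maximalAtlas x
  have hs : ∀ e y i j, comp T e y i j = comp T e y j i := fun e y i j => hsymm _ _ _
  -- Continuity is read off in charts, since the standard frame defining `gram` need not vary
  -- continuously with the point.
  have hcont : Continuous (negDet q T) := by
    rw [continuous_iff_continuousAt]
    intro x
    have hx := mem_chart_source E2 x
    have hy := (chartAt E2 x).map_source hx
    have h1 := ((isMetricOn_comp q (hchart x)).contDiffAt_det_quotient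
      (hsmooth _ (hchart x)) hy).continuousAt
    have h2 : ContinuousAt (fun z => negDet q T ((chartAt E2 x).symm z)) (chartAt E2 x x) :=
      h1.congr (Filter.eventuallyEq_of_mem ((chartAt E2 x).open_target.mem_nhds hy)
        fun z hz => (negDet_symm_apply q hsymm (hchart x) hz).symm)
    have h3 := ContinuousAt.comp (f := chartAt E2 x) h2 ((chartAt E2 x).continuousAt hx)
    refine h3.congr (Filter.eventuallyEq_of_mem ((chartAt E2 x).open_source.mem_nhds hx)
      fun z hz => ?_)
    simp [(chartAt E2 x).left_inv hz]
  obtain ⟨x₀, -, hx₀'⟩ := isCompact_univ.exists_isMaxOn ⟨x, Set.mem_univ x⟩ hcont.continuousOn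
  have hx₀ : ∀ z, negDet q T z ≤ negDet q T x₀ := fun z => hx₀' (Set.mem_univ z)
  have hle : negDet q T x₀ ≤ 0 := by
    set e := chartAt E2 x₀ with he
    have hy := e.map_source (mem_chart_source E2 x₀)
    have hmax : IsLocalMax (fun z => (comp T e z 0 1 ^ 2 - comp T e z 0 0 * comp T e z 1 1) /
        (comp q.inner e z 0 0 * comp q.inner e z 1 1 - comp q.inner e z 0 1 ^ 2)) (e x₀) := by
      filter_upwards [e.open_target.mem_nhds hy] with z hz
      rw [← negDet_symm_apply q hsymm (hchart x₀) hz, ← negDet_symm_apply q hsymm (hchart x₀) hy,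
        e.left_inv (mem_chart_source E2 x₀)]
      exact hx₀ _
    have hN := (isMetricOn_comp q (hchart x₀)).det_nonneg_of_isLocalMax (hsmooth _ (hchart x₀))
      (hs e) (htr _ (hchart x₀)) (hC _ (hchart x₀)) hy (by rw [hq _ (hchart x₀) _ hy]; exact hR)
      hmax
    have := negDet_symm_apply q hsymm (hchart x₀) hy
    rw [e.left_inv (mem_chart_source E2 x₀)] at this
    rw [this]
    exact div_nonpos_of_nonpos_of_nonneg hN ((isMetricOn_comp q (hchart x₀)).det_pos _ hy).le
  have hx := mem_chart_source E2 x
  have hy := (chartAt E2 x).map_source hx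
  have hg := isMetricOn_comp q (hchart x)
  have hdet : comp T (chartAt E2 x) (chartAt E2 x x) 0 1 ^ 2
      - comp T (chartAt E2 x) (chartAt E2 x x) 0 0 * comp T (chartAt E2 x) (chartAt E2 x x) 1 1
      ≤ 0 := by
    have h := negDet_symm_apply q hsymm (hchart x) hy
    rw [(chartAt E2 x).left_inv hx, eq_div_iff (hg.det_pos _ hy).ne'] at h
    rw [← h]
    exact mul_nonpos_of_nonpos_of_nonneg ((hx₀ x).trans hle) (hg.det_pos _ hy).le
  obtain ⟨ha, hb, hc⟩ := eq_zero_of_trace_det (hg.pos _ hy) (hg.det_pos _ hy)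
    (htr _ (hchart x) _ hy) hdet
  refine eq_zero_of_comp_eq_zero (hchart x) hx ?_
  ext i j
  fin_cases i <;> fin_cases j
  · exact ha
  · exact hb
  · exact (hs _ _ _ _).trans hb
  · exact hc

/-! ### The constraints -/

theorem comp_sub_smul (S : Tensor2) (q : Metric2) (c : ℝ) (e : OpenPartialHomeomorph Sph E2)
    (y : E2) (i j : Fin 2) : comp (fun x => S x - c • q.inner x) e y i j =
      comp S e y i j - c * comp q.inner e y i j := rfl

theorem comp_smul (q : Metric2) (c : ℝ) (e : OpenPartialHomeomorph Sph E2)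
    (y : E2) (i j : Fin 2) : comp (fun x => c • q.inner x) e y i j = c * comp q.inner e y i j :=
  rfl

theorem trace_eq {g : E2 → Matrix (Fin 2) (Fin 2) ℝ} {U : Set E2} (hg : IsMetricOn g U)
    {T : Matrix (Fin 2) (Fin 2) ℝ} (hT : T 1 0 = T 0 1) (y : E2) :
    ∑ M, ∑ N, (g y)⁻¹ M N * T M N =
      (g y 1 1 * T 0 0 - 2 * (g y 0 1 * T 0 1) + g y 0 0 * T 1 1) /
        (g y 0 0 * g y 1 1 - g y 0 1 ^ 2) := by
  simp only [hg.inv_apply, Fin.sum_univ_two, hT, Matrix.of_apply, Matrix.cons_val',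
    Matrix.cons_val_zero, Matrix.cons_val_one, Matrix.cons_val_fin_one]
  ring

theorem covDeriv_sub_smul_self {g T : E2 → Matrix (Fin 2) (Fin 2) ℝ} {U : Set E2}
    (hg : IsMetricOn g U) {y : E2} (hy : y ∈ U) (c : ℝ) {S : E2 → Matrix (Fin 2) (Fin 2) ℝ}
    (hS : ∀ i j, ContDiffAt ℝ ∞ (fun z => S z i j) y)
    (hT : ∀ z i j, T z i j = S z i j - c * g z i j) (M N P : Fin 2) :
    covDeriv g T M N P y = covDeriv g S M N P y := by
  have h : (fun z => T z N P) = fun z => S z N P - c * g z N P := funext fun z => hT z N P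
  have h0 := hg.covDeriv_self hy M N P
  have hd := (hg.smooth y hy N P).diffAt
  unfold covDeriv at h0 ⊢
  rw [h, pd_sub M (hS N P).diffAt (hd.const_mul c), pd_const_mul M c hd]
  simp only [hT, Fin.sum_univ_two] at h0 ⊢
  linear_combination (-c) * h0

theorem covDeriv_smul_self {g T : E2 → Matrix (Fin 2) (Fin 2) ℝ} {U : Set E2}
    (hg : IsMetricOn g U) {y : E2} (hy : y ∈ U) (c : ℝ)
    (hT : ∀ z i j, T z i j = c * g z i j) (M N P : Fin 2) : covDeriv g T M N P y = 0 := by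
  have h : (fun z => T z N P) = fun z => c * g z N P := funext fun z => hT z N P
  have h0 := hg.covDeriv_self hy M N P
  unfold covDeriv at h0 ⊢
  rw [h, pd_const_mul M c (hg.smooth y hy N P).diffAt]
  simp only [hT, Fin.sum_univ_two] at h0 ⊢
  linear_combination c * h0

theorem eq_smul_metric_of_constraints (q : Metric2) {R : ℝ} (hR : 0 < R)
    (hq : HasScalarCurvature q R) {J : Set ℝ} {S : ℝ → Tensor2} (hS : SmoothOn J S)
    (hSs : SymmOn J S) (hC : CodazziOn q J S) (htr : TraceOn q R J S) {u : ℝ} (hu : u ∈ J)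
    (x : Sph) : S u x = (R / 2) • q.inner x := by
  have hsm : ∀ e, IsChart e → ∀ y ∈ e.target, ∀ i j,
      ContDiffAt ℝ ∞ (fun z => comp (S u) e z i j) y := by
    intro e he y hy i j
    have h := (hS e he i j).comp (g := fun p : ℝ × E2 => comp (S p.1) e p.2 i j)
      (f := fun z : E2 => (u, z)) (s := e.target)
      (contDiff_const.prodMk contDiff_id).contDiffOn (fun z hz => ⟨hu, hz⟩)
    exact h.contDiffAt (e.open_target.mem_nhds hy)
  refine sub_eq_zero.1 (eq_zero_of_codazzi q hR hq (T := fun x => S u x - (R / 2) • q.inner x)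
    ?_ ?_ ?_ ?_ x)
  · intro e he y hy i j
    exact (hsm e he y hy i j).sub (contDiffAt_const.mul ((isMetricOn_comp q he).smooth y hy i j))
  · intro x v w
    have h1 := hSs u hu x v w
    have h2 := q.symm x v w
    simp only [sub_apply, smul_apply, h1, h2]
  · intro e he y hy
    have hg := isMetricOn_comp q he
    have h := htr u hu e he y hy
    rw [trace_eq hg (hSs u hu _ _ _), div_eq_iff (hg.det_pos y hy).ne'] at h
    simp only [comp_sub_smul]
    linear_combination h
  · intro e he y hy M N P
    have hg := isMetricOn_comp q he
    rw [covDeriv_sub_smul_self hg hy (R / 2) (hsm e he y hy) (comp_sub_smul (S u) q (R / 2) e),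
      covDeriv_sub_smul_self hg hy (R / 2) (hsm e he y hy) (comp_sub_smul (S u) q (R / 2) e)]
    exact sub_eq_zero.1 (hC u hu e he y hy M N P)

theorem comp_eq_of_eq_smul {q : Metric2} {c : ℝ} {S : Tensor2} (h : ∀ x, S x = c • q.inner x)
    (e : OpenPartialHomeomorph Sph E2) (y : E2) (i j : Fin 2) :
    comp S e y i j = c * comp q.inner e y i j := by
  rw [show S = fun x => c • q.inner x from funext h, comp_smul]

theorem constraints_of_eq_smul_metric (q : Metric2) (R : ℝ) {J : Set ℝ} (hJ : IsOpen J)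
    {S : ℝ → Tensor2} (h : ∀ u ∈ J, ∀ x, S u x = (R / 2) • q.inner x) :
    SmoothOn J S ∧ SymmOn J S ∧ CodazziOn q J S ∧ StationaryOn J S ∧ TraceOn q R J S := by
  refine ⟨?_, ?_, ?_, ?_, ?_⟩
  · intro e he M N
    have h1 : ContDiffOn ℝ ∞ (fun p : ℝ × E2 => R / 2 * comp q.inner e p.2 M N)
        (J ×ˢ e.target) :=
      contDiffOn_const.mul ((contDiffOn_comp_metric q he M N).comp contDiff_snd.contDiffOn
        fun p hp => hp.2)
    exact h1.congr fun p hp => comp_eq_of_eq_smul (h p.1 hp.1) e p.2 M N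
  · intro u hu x v w
    rw [h u hu x]
    simp only [smul_apply, q.symm x v w]
  · intro u hu e he y hy M N P
    have hg := isMetricOn_comp q he
    rw [covDeriv_smul_self hg hy (R / 2) (comp_eq_of_eq_smul (h u hu) e),
      covDeriv_smul_self hg hy (R / 2) (comp_eq_of_eq_smul (h u hu) e), sub_zero]
  · intro u hu e he y hy M N
    -- Openness of `J` makes the components constant for all `s` near `u`, which the derivative
    -- requires.
    have h1 : (fun s => comp (S s) e y M N) =ᶠ[nhds u] fun _ => R / 2 * comp q.inner e y M N :=
      Filter.eventuallyEq_of_mem (hJ.mem_nhds hu)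
        fun s hs => comp_eq_of_eq_smul (h s hs) e y M N
    rw [h1.deriv_eq, deriv_const]
  · intro u hu e he y hy
    have hg := isMetricOn_comp q he
    have hc := comp_eq_of_eq_smul (h u hu) e y
    rw [trace_eq hg (by rw [hc, hc, hg.symm y 1 0]), div_eq_iff (hg.det_pos y hy).ne']
    simp only [hc]
    ring

end NullInfinity

end

theorem mainTheorem8 (q : NullInfinity.Metric2) (R : ℝ) (hR : 0 < R)
    (hq : NullInfinity.HasScalarCurvature q R)
    (J : Set ℝ) (hJ : IsOpen J) (S : ℝ → NullInfinity.Tensor2) :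
    (NullInfinity.SmoothOn J S ∧ NullInfinity.SymmOn J S ∧
        NullInfinity.CodazziOn q J S ∧ NullInfinity.StationaryOn J S ∧
        NullInfinity.TraceOn q R J S) ↔
      ∀ u ∈ J, ∀ x : NullInfinity.Sph, S u x = (R / 2) • q.inner x :=
  ⟨fun ⟨hS, hs, hC, _, htr⟩ _ hu x =>
      NullInfinity.eq_smul_metric_of_constraints q hR hq hS hs hC htr hu x,
    NullInfinity.constraints_of_eq_smul_metric q R hJ⟩
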